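/- Let $n\ge 1$ be an integer, let $\frac12<s<1$, and let $B_1=\{x\in\mathbb{R}^n:|x|<1\}$. Let $\vec b\in L^\infty(B_1;\mathbb{R}^n)$ and $c\in L^\infty(B_1)$ with $c\ge 0$ a.e. in $B_1$. Let $u\in C(\mathbb{R}^n)\cap C^1(B_1)$ be a real-valued function with $u\in\mathcal{L}_{2s}$, i.e. $$\int_{\mathbb{R}^n}\frac{|u(y)|}{1+|y|^{n+2s}}\,dy<\infty .$$ For $\varphi\in C_0^\infty(\mathbb{R}^n)$ let $$(-\Delta)^s\varphi(x)=C_{n,s}\,\mathrm{P.V.}\!\int_{\mathbb{R}^n}\frac{\varphi(x)-\varphi(y)}{|x-y|^{n+2s}}\,dy,\qquad C_{n,s}=\frac{s\,4^s\,\Gamma(\frac n2+s)}{\pi^{n/2}\,\Gamma(1-s)} .$$ Suppose that $$(-\Delta)^su+\vec b\cdot\nabla u+cu\ge 0\quad\text{in }\mathcal{D}'(B_1),$$ that is, for every $\varphi\in C_0^\infty(B_1)$ with $\varphi\ge 0$, $$\int_{\mathbb{R}^n}u\,(-\Delta)^s\varphi\,dx+\int_{B_1}\bigl(\vec b\cdot\nabla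 u+cu\bigr)\varphi\,dx\ \ge\ 0,$$ and that $u\ge 0$ in $\mathbb{R}^n\setminus B_1$. Then $u\ge 0$ in $B_1$. -/

import Mathlib

open MeasureTheory Metric Topology Filter

open scoped Distributions

namespace FracMax

noncomputable section

/-- The normalizing constant `C_{n,s} = s 4^s Γ(n/2 + s) / (π^{n/2} Γ(1 - s))` for which the
fractional Laplacian on `ℝⁿ` has the Fourier symbol `(2π|ξ|)^{2s}` (for the Fourier transform with
kernel `exp(-2πi x·ξ)`). -/
def fracConst (n : ℕ) (s : ℝ) : ℝ :=
  s * (4 : ℝ) ^ s * Real.Gamma ((n : ℝ) / 2 + s) /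
    (Real.pi ^ ((n : ℝ) / 2) * Real.Gamma (1 - s))

/-- The fractional Laplacian
`(-Δ)^s φ (x) = C_{n,s} P.V. ∫ (φ(x) - φ(y)) / |x - y|^{n+2s} dy`,
the principal value being the limit as `ε → 0+` of the integrals over `|y - x| ≥ ε`.
It is applied below to test functions only, for which this limit exists at every point when
`0 < s < 1`. -/
def fracLaplacian {n : ℕ} (s : ℝ) (φ : EuclideanSpace ℝ (Fin n) → ℝ)
    (x : EuclideanSpace ℝ (Fin n)) : ℝ :=
  fracConst n s *
    limUnder (𝓝[>] (0 : ℝ)) (fun ε : ℝ =>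
      ∫ y in (ball x ε)ᶜ, (φ x - φ y) / ‖x - y‖ ^ ((n : ℝ) + 2 * s))

/-- The space `𝓛_{2s}`: measurable functions with
`∫ |u(y)| / (1 + |y|^{n+2s}) dy < ∞` (integrability includes the absolute value). -/
def MemL2s {n : ℕ} (s : ℝ) (u : EuclideanSpace ℝ (Fin n) → ℝ) : Prop :=
  Integrable (fun y => u y / (1 + ‖y‖ ^ ((n : ℝ) + 2 * s)))

/-- The fractional Laplacian of `w` as a distribution on `Ω`:
`(-Δ)^s w [φ] = ∫ w (-Δ)^s φ dx`. -/
def distribFracLaplacian {n : ℕ} (s : ℝ) (Ω : TopologicalSpace.Opens (EuclideanSpace ℝ (Fin n)))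
    (w : EuclideanSpace ℝ (Fin n) → ℝ) (φ : 𝓓(Ω, ℝ)) : ℝ :=
  ∫ x, w x * fracLaplacian s φ x

/-- The inequality `(-Δ)^s u + b · ∇u + c u ≥ 0` in `𝓓'(Ω)`, for `u` that is `C¹` in `Ω`: the
distribution on the left is nonnegative on every nonnegative test function. -/
def IsSupersolution {n : ℕ} (s : ℝ) (Ω : TopologicalSpace.Opens (EuclideanSpace ℝ (Fin n)))
    (b : EuclideanSpace ℝ (Fin n) → EuclideanSpace ℝ (Fin n))
    (c u : EuclideanSpace ℝ (Fin n) → ℝ) : Prop :=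
  ∀ φ : 𝓓(Ω, ℝ), (∀ x, 0 ≤ φ x) →
    0 ≤ distribFracLaplacian s Ω u φ +
      ∫ x in (Ω : Set (EuclideanSpace ℝ (Fin n))),
        (inner ℝ (b x) (gradient u x) + c x * u x) * φ x

/-- The open unit ball `B₁` of `ℝⁿ`, as a bundled open set. -/
def unitBall (n : ℕ) : TopologicalSpace.Opens (EuclideanSpace ℝ (Fin n)) :=
  ⟨ball 0 1, isOpen_ball⟩

end

end FracMax

namespace FracMax

/-! If `u` is negative somewhere, it attains a negative global minimum `-M` at some `x₀` in the
ball. There `∇u` vanishes and `c u ≤ 0`, so the lower order terms are almost nonpositive near `x₀`.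
Meanwhile the nonlocal term should be strictly negative, since `u ≥ 0` far away while `u x₀ = -M`.
As `u` is only `C¹`, `(-Δ)^s u` cannot be evaluated at `x₀`, so the inequality is tested against a
translated mollifier `ρ(· - a)`.

Moving the truncated operator across the pairing by Fubini (`integral_mul_truncFracLap`) produces
increments of the mollification `U` at `a`. These have a sign up to a small error if `a` minimizes
`U - δ ζ`, where `ζ` is a bump around `x₀`; the bump keeps `a` near `x₀` (`exists_contact_point`).
The far increments gain a fixed multiple of `M`, while `ζ` costs `O(δ)` uniformly in the cutoff
(`integral_mul_truncFracLap_le`, `exists_abs_truncFracLap_le`). Letting the cutoff tend to `0`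
(`tendsto_integral_mul_truncFracLap`) contradicts the supersolution inequality. -/

variable {n : ℕ}

/-! ### Truncated kernels and their integrability. -/

/-- The kernel `‖h‖⁻ᵖ` cut off at distance `ε` from the origin. -/
noncomputable def truncKernel (p ε : ℝ) (h : EuclideanSpace ℝ (Fin n)) : ℝ :=
  (ball (0 : EuclideanSpace ℝ (Fin n)) ε)ᶜ.indicator (fun h => (‖h‖ ^ p)⁻¹) h

/-- The fractional Laplacian, without its constant, with kernel cut off at distance `ε`. -/
noncomputable def truncFracLap (p ε : ℝ) (φ : EuclideanSpace ℝ (Fin n) → ℝ)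
    (y : EuclideanSpace ℝ (Fin n)) : ℝ :=
  ∫ h, (φ y - φ (y + h)) * truncKernel p ε h

theorem truncKernel_of_le {p ε : ℝ} {h : EuclideanSpace ℝ (Fin n)} (hh : ε ≤ ‖h‖) :
    truncKernel p ε h = (‖h‖ ^ p)⁻¹ := by
  simp [truncKernel, hh]

theorem truncKernel_of_lt {p ε : ℝ} {h : EuclideanSpace ℝ (Fin n)} (hh : ‖h‖ < ε) :
    truncKernel p ε h = 0 := by
  simp [truncKernel, hh]

theorem truncKernel_nonneg (p ε : ℝ) (h : EuclideanSpace ℝ (Fin n)) : 0 ≤ truncKernel p ε h :=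
  Set.indicator_nonneg (fun _ _ => by positivity) _

theorem truncKernel_le (p ε : ℝ) (h : EuclideanSpace ℝ (Fin n)) :
    truncKernel p ε h ≤ (‖h‖ ^ p)⁻¹ :=
  Set.indicator_le_self' (fun _ _ => by positivity) _

theorem truncKernel_neg (p ε : ℝ) (h : EuclideanSpace ℝ (Fin n)) :
    truncKernel p ε (-h) = truncKernel p ε h := by
  rcases le_or_gt ε ‖h‖ with hh | hh
  · rw [truncKernel_of_le (by simpa using hh), truncKernel_of_le hh, norm_neg]
  · rw [truncKernel_of_lt (by simpa using hh), truncKernel_of_lt hh]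

theorem measurable_truncKernel (p ε : ℝ) :
    Measurable (truncKernel p ε : EuclideanSpace ℝ (Fin n) → ℝ) :=
  Measurable.indicator (by fun_prop) measurableSet_ball.compl

/-- The weight that controls second differences of smooth functions against `‖h‖⁻ᵖ`. -/
theorem integrable_min_one_sq_mul_rpow (hn : 1 ≤ n) {p : ℝ} (h1 : (n : ℝ) < p)
    (h2 : p < n + 2) :
    Integrable (fun h : EuclideanSpace ℝ (Fin n) => min 1 (‖h‖ ^ 2) * (‖h‖ ^ p)⁻¹) := by
  have : Nonempty (Fin n) := ⟨⟨0, hn⟩⟩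
  have := (integrable_fun_norm_addHaar (volume : Measure (EuclideanSpace ℝ (Fin n)))
    (f := fun t : ℝ => min 1 (t ^ 2) * (t ^ p)⁻¹)).2
  refine this ?_
  rw [finrank_euclideanSpace_fin, ← Set.Ioc_union_Ioi_eq_Ioi zero_le_one]
  -- In polar coordinates the integrand is `t^(n+1-p)` on `(0,1]` and `t^(n-1-p)` beyond; `n < p < n
  -- + 2` puts the exponents on the integrable sides of `-1`.
  refine IntegrableOn.union ?_ ?_
  · have h : IntegrableOn (fun t : ℝ => t ^ ((n : ℝ) + 1 - p)) (Set.Ioc 0 1) :=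
      (intervalIntegrable_iff_integrableOn_Ioc_of_le zero_le_one).1
        (intervalIntegral.intervalIntegrable_rpow' (by linarith))
    refine h.congr_fun (fun t ht => ?_) measurableSet_Ioc
    have ht2 : t ^ 2 ≤ 1 := pow_le_one₀ ht.1.le ht.2
    simp only [smul_eq_mul]
    rw [min_eq_right ht2, ← Real.rpow_neg ht.1.le, ← Real.rpow_natCast, ← Real.rpow_natCast,
      ← Real.rpow_add ht.1, ← Real.rpow_add ht.1]
    congr 1
    push_cast [Nat.cast_sub hn]
    ring
  · have h : IntegrableOn (fun t : ℝ => t ^ ((n : ℝ) - 1 - p)) (Set.Ioi 1) :=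
      integrableOn_Ioi_rpow_of_lt (by linarith) one_pos
    refine h.congr_fun (fun t ht => ?_) measurableSet_Ioi
    have ht1 : (1 : ℝ) < t := ht
    have ht2 : 1 ≤ t ^ 2 := one_le_pow₀ ht1.le
    have ht0 : 0 < t := by linarith
    simp only [smul_eq_mul]
    rw [min_eq_left ht2, one_mul, ← Real.rpow_neg ht0.le, ← Real.rpow_natCast,
      ← Real.rpow_add ht0]
    congr 1
    push_cast [Nat.cast_sub hn]
    ring

theorem integrable_truncKernel (hn : 1 ≤ n) {p ε : ℝ} (h1 : (n : ℝ) < p)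
    (h2 : p < n + 2) (hε : 0 < ε) :
    Integrable (truncKernel p ε : EuclideanSpace ℝ (Fin n) → ℝ) := by
  have hm : 0 < min 1 (ε ^ 2) := by positivity
  refine ((integrable_min_one_sq_mul_rpow hn h1 h2).const_mul (min 1 (ε ^ 2))⁻¹).mono'
    (measurable_truncKernel p ε).aestronglyMeasurable (ae_of_all _ fun h => ?_)
  rw [Real.norm_of_nonneg (truncKernel_nonneg _ _ _)]
  rcases le_or_gt ε ‖h‖ with hh | hh
  · rw [truncKernel_of_le hh, ← mul_assoc]
    refine le_mul_of_one_le_left (by positivity) ?_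
    rw [inv_mul_eq_div, one_le_div hm]
    gcongr
  · rw [truncKernel_of_lt hh]
    positivity

/-- The map `z ↦ φ (y + z) + φ (y - z)` has derivative `Dφ(y + z) - Dφ(y - z)`, of norm at most
`2L‖z‖` since `Dφ` is Lipschitz; the mean value inequality gives the quadratic bound, and
boundedness of `φ` the other. -/
theorem exists_second_difference_le {φ : EuclideanSpace ℝ (Fin n) → ℝ} (hφ : ContDiff ℝ 2 φ)
    (hc : HasCompactSupport φ) :
    ∃ K, 0 ≤ K ∧ ∀ y h, |2 * φ y - φ (y + h) - φ (y - h)| ≤ K * min 1 (‖h‖ ^ 2) := by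
  obtain ⟨L, hL⟩ := ContDiff.lipschitzWith_of_hasCompactSupport (𝕂 := ℝ) (hc.fderiv ℝ)
    (hφ.fderiv_right (m := 1) (by norm_num)) one_ne_zero
  obtain ⟨M, hM⟩ := hc.exists_bound_of_continuous hφ.continuous
  have hM0 : 0 ≤ M := (norm_nonneg _).trans (hM 0)
  have hd : Differentiable ℝ φ := hφ.differentiable (by norm_num)
  refine ⟨max (4 * M) (2 * L), by positivity, fun y h => ?_⟩
  have A : |2 * φ y - φ (y + h) - φ (y - h)| ≤ 4 * M := by
    have e1 := abs_le.1 (hM y)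
    have e2 := abs_le.1 (hM (y + h))
    have e3 := abs_le.1 (hM (y - h))
    rw [abs_le]
    constructor <;> linarith [e1.1, e1.2, e2.1, e2.2, e3.1, e3.2]
  have B : |2 * φ y - φ (y + h) - φ (y - h)| ≤ 2 * L * ‖h‖ ^ 2 := by
    have hder : ∀ z, HasFDerivAt (fun z => φ (y + z) + φ (y - z))
        (fderiv ℝ φ (y + z) - fderiv ℝ φ (y - z)) z := fun z => by
      have e1 : HasFDerivAt (fun z => φ (y + z)) (fderiv ℝ φ (y + z)) z := by
        have := (hd (y + z)).hasFDerivAt.comp z ((hasFDerivAt_id z).const_add y)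
        simpa [Function.comp_def] using this
      have e2 : HasFDerivAt (fun z => φ (y - z)) (-fderiv ℝ φ (y - z)) z := by
        have := (hd (y - z)).hasFDerivAt.comp z ((hasFDerivAt_id z).const_sub y)
        simpa [Function.comp_def] using this
      rw [sub_eq_add_neg]
      exact e1.add e2
    have := (convex_closedBall
      (0 : EuclideanSpace ℝ (Fin n)) ‖h‖).norm_image_sub_le_of_norm_fderiv_le (𝕜 := ℝ)
      (f := fun z => φ (y + z) + φ (y - z)) (C := 2 * L * ‖h‖) (x := 0) (y := h)
      (fun z _ => (hder z).differentiableAt) (fun z hz => by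
        rw [(hder z).fderiv, ← dist_eq_norm]
        refine (hL.dist_le_mul _ _).trans ?_
        have e : y + z - (y - z) = (2 : ℝ) • z := by rw [two_smul]; abel
        rw [dist_eq_norm, e, norm_smul, Real.norm_ofNat]
        have : ‖z‖ ≤ ‖h‖ := by simpa using hz
        nlinarith [L.2, mul_le_mul_of_nonneg_left this L.2]) (by simp) (by simp)
    simp only [add_zero, sub_zero, Real.norm_eq_abs] at this
    rw [abs_sub_comm] at this
    calc _ = |φ y + φ y - (φ (y + h) + φ (y - h))| := by congr 1; ring
      _ ≤ _ := this
      _ = _ := by ring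
  rw [mul_min_of_nonneg _ _ (by positivity), mul_one]
  exact le_min (A.trans (le_max_left _ _)) (B.trans (by gcongr; exact le_max_right _ _))

/-- Decay of the kernel seen from a bounded set. -/
theorem exists_truncKernel_le {p ε : ℝ} (hp : 0 < p) (hε : 0 < ε) (R : ℝ) :
    ∃ K, 0 ≤ K ∧ ∀ y h : EuclideanSpace ℝ (Fin n), ‖y + h‖ ≤ R →
      truncKernel p ε h ≤ K / (1 + ‖y‖ ^ p) := by
  -- On `‖h‖ ≥ ε` one has `‖y‖ ≤ |R| + ‖h‖ ≤ (1 + |R|/ε)‖h‖`; the two summands pay for `1` and for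
  -- `‖y‖ ^ p`.
  refine ⟨(ε ^ p)⁻¹ + (1 + |R| / ε) ^ p, by positivity, fun y h hyh => ?_⟩
  rcases le_or_gt ε ‖h‖ with hh | hh
  · have h0 : 0 < ‖h‖ := hε.trans_le hh
    have hy : ‖y‖ ≤ (1 + |R| / ε) * ‖h‖ := by
      have e1 : ‖y‖ ≤ ‖y + h‖ + ‖h‖ := by simpa using norm_sub_le (y + h) h
      have e2 : |R| ≤ |R| / ε * ‖h‖ := by
        rw [div_mul_eq_mul_div, le_div_iff₀ hε]
        gcongr
      linarith [le_abs_self R]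
    rw [truncKernel_of_le hh, le_div_iff₀ (by positivity), mul_add, mul_one]
    gcongr
    rw [inv_mul_le_iff₀ (by positivity), ← Real.mul_rpow h0.le (by positivity)]
    gcongr
    linarith
  · rw [truncKernel_of_lt hh]
    positivity

/-! ### Truncated fractional Laplacians: uniform bounds and the limit `ε → 0`. -/

theorem truncFracLap_eq_setIntegral (p ε : ℝ) (φ : EuclideanSpace ℝ (Fin n) → ℝ)
    (x : EuclideanSpace ℝ (Fin n)) :
    truncFracLap p ε φ x = ∫ y in (ball x ε)ᶜ, (φ x - φ y) / ‖x - y‖ ^ p := by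
  rw [← integral_indicator measurableSet_ball.compl, ← integral_add_left_eq_self _ x]
  refine integral_congr_ae (ae_of_all _ fun h => ?_)
  rcases le_or_gt ε ‖h‖ with hh | hh
  · simp [truncKernel_of_le hh, hh, div_eq_mul_inv]
  · simp [truncKernel_of_lt hh, hh]

variable {p ε : ℝ} {φ : EuclideanSpace ℝ (Fin n) → ℝ}

theorem integrable_mul_truncKernel (hn : 1 ≤ n) (h1 : (n : ℝ) < p) (h2 : p < n + 2) (hε : 0 < ε)
    {f : EuclideanSpace ℝ (Fin n) → ℝ} (hf : AEStronglyMeasurable f) {M : ℝ}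
    (hM : ∀ x, |f x| ≤ M) : Integrable (fun h => f h * truncKernel p ε h) :=
  (integrable_truncKernel hn h1 h2 hε).bdd_mul hf (ae_of_all _ hM)

theorem integrable_sub_mul_truncKernel (hn : 1 ≤ n) (h1 : (n : ℝ) < p) (h2 : p < n + 2)
    (hε : 0 < ε) (hφ : Continuous φ) (hc : HasCompactSupport φ) (y : EuclideanSpace ℝ (Fin n)) :
    Integrable (fun h => (φ y - φ (y + h)) * truncKernel p ε h) := by
  obtain ⟨M, hM⟩ := hc.exists_bound_of_continuous hφ
  exact integrable_mul_truncKernel hn h1 h2 hε (M := M + M)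
    (by fun_prop) fun h => (norm_sub_le _ _).trans (add_le_add (hM _) (hM _))

theorem integrable_sub_comp_sub_mul_truncKernel (hn : 1 ≤ n) (h1 : (n : ℝ) < p) (h2 : p < n + 2)
    (hε : 0 < ε) (hφ : Continuous φ) (hc : HasCompactSupport φ) (y : EuclideanSpace ℝ (Fin n)) :
    Integrable (fun h => (φ y - φ (y - h)) * truncKernel p ε h) := by
  have := (integrable_sub_mul_truncKernel hn h1 h2 hε hφ hc y).comp_neg
  simpa [truncKernel_neg, sub_eq_add_neg] using this

theorem integral_sub_comp_sub_mul_truncKernel (p ε : ℝ) (φ : EuclideanSpace ℝ (Fin n) → ℝ)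
    (y : EuclideanSpace ℝ (Fin n)) :
    ∫ h, (φ y - φ (y - h)) * truncKernel p ε h = truncFracLap p ε φ y := by
  rw [truncFracLap, ← integral_neg_eq_self]
  simp [truncKernel_neg, sub_eq_add_neg]

/-- The kernel is even, so averaging over `h` and `-h` cancels the first order term; this is what
makes bounds uniform in `ε` possible. -/
theorem truncFracLap_eq_second_difference (hn : 1 ≤ n) (h1 : (n : ℝ) < p) (h2 : p < n + 2)
    (hε : 0 < ε) (hφ : Continuous φ) (hc : HasCompactSupport φ) (y : EuclideanSpace ℝ (Fin n)) :
    truncFracLap p ε φ y =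
      (∫ h, (2 * φ y - φ (y + h) - φ (y - h)) * truncKernel p ε h) / 2 := by
  have : (∫ h, (2 * φ y - φ (y + h) - φ (y - h)) * truncKernel p ε h) =
      truncFracLap p ε φ y + truncFracLap p ε φ y := by
    nth_rewrite 2 [← integral_sub_comp_sub_mul_truncKernel]
    rw [truncFracLap, ← integral_add (integrable_sub_mul_truncKernel hn h1 h2 hε hφ hc y)
      (integrable_sub_comp_sub_mul_truncKernel hn h1 h2 hε hφ hc y)]
    congr 1
    ext h
    ring
  rw [this]
  ring

theorem exists_abs_truncFracLap_le (hn : 1 ≤ n) (h1 : (n : ℝ) < p) (h2 : p < n + 2)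
    (hφ : ContDiff ℝ 2 φ) (hc : HasCompactSupport φ) :
    ∃ K, 0 ≤ K ∧ ∀ ε, 0 < ε → ∀ y, |truncFracLap p ε φ y| ≤ K := by
  obtain ⟨K, hK0, hK⟩ := exists_second_difference_le hφ hc
  refine ⟨(∫ h : EuclideanSpace ℝ (Fin n), K * (min 1 (‖h‖ ^ 2) * (‖h‖ ^ p)⁻¹)) / 2,
    by positivity, fun ε hε y => ?_⟩
  rw [truncFracLap_eq_second_difference hn h1 h2 hε hφ.continuous hc, abs_div, abs_two,
    ← Real.norm_eq_abs]
  gcongr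
  refine norm_integral_le_of_norm_le ((integrable_min_one_sq_mul_rpow hn h1 h2).const_mul K)
    (ae_of_all _ fun h => ?_)
  rw [norm_mul, Real.norm_of_nonneg (truncKernel_nonneg _ _ _), ← mul_assoc]
  exact mul_le_mul (hK y h) (truncKernel_le _ _ _) (truncKernel_nonneg _ _ _) (by positivity)

/-- Near the support the uniform bound suffices. Far from it `φ y = 0`, and only those `h` count
that carry `y` back into the support, where the kernel decays like `‖y‖⁻ᵖ`. The decay matches the
weight in `MemL2s`, hence supplies a dominating function. -/
theorem exists_abs_truncFracLap_le_decay (hn : 1 ≤ n) (h1 : (n : ℝ) < p) (h2 : p < n + 2)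
    (hφ : ContDiff ℝ 2 φ) (hc : HasCompactSupport φ) :
    ∃ K, 0 ≤ K ∧ ∀ ε, 0 < ε → ε ≤ 1 → ∀ y, |truncFracLap p ε φ y| ≤ K / (1 + ‖y‖ ^ p) := by
  have hp : 0 < p := (Nat.cast_nonneg n).trans_lt h1
  obtain ⟨K, hK0, hK⟩ := exists_abs_truncFracLap_le hn h1 h2 hφ hc
  obtain ⟨R, hR0, hR⟩ := hc.isCompact.isBounded.exists_pos_norm_le
  obtain ⟨K', hK'0, hK'⟩ := exists_truncKernel_le (n := n) hp one_pos R
  have hφ0 : ∀ z, R < ‖z‖ → φ z = 0 := fun z hz =>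
    image_eq_zero_of_notMem_tsupport fun h => hz.not_ge (hR z h)
  set I := ∫ z, |φ z|
  have hI : 0 ≤ I := integral_nonneg fun _ => abs_nonneg _
  refine ⟨K * (1 + (R + 1) ^ p) + K' * I, by positivity, fun ε hε hε1 y => ?_⟩
  rcases le_or_gt ‖y‖ (R + 1) with hy | hy
  · refine (hK ε hε y).trans ?_
    rw [le_div_iff₀ (by positivity)]
    have : K * (1 + ‖y‖ ^ p) ≤ K * (1 + (R + 1) ^ p) := by gcongr
    have : 0 ≤ K' * I := by positivity
    linarith
  · have hb : |truncFracLap p ε φ y| ≤ ∫ h, |φ (y + h)| * (K' / (1 + ‖y‖ ^ p)) := by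
      have hint : Integrable (fun z => |φ z|) :=
        (hφ.continuous.integrable_of_hasCompactSupport hc).abs
      rw [← Real.norm_eq_abs, truncFracLap]
      refine norm_integral_le_of_norm_le
        ((hint.comp_add_left y).mul_const _) (ae_of_all _ fun h => ?_)
      rw [hφ0 y (by linarith), zero_sub, norm_mul, norm_neg, Real.norm_eq_abs,
        Real.norm_of_nonneg (truncKernel_nonneg _ _ _)]
      rcases le_or_gt ‖y + h‖ R with hz | hz
      · have hh : 1 ≤ ‖h‖ := by
          have : ‖y‖ ≤ ‖y + h‖ + ‖h‖ := by simpa using norm_sub_le (y + h) h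
          linarith
        gcongr
        -- At `‖h‖ ≥ 1` the cutoffs `ε` and `1` give the same kernel, so `K'` does not depend on
        -- `ε`.
        rw [truncKernel_of_le (hε1.trans hh), ← truncKernel_of_le hh]
        exact hK' y h hz
      · simp [hφ0 _ hz]
    rw [integral_mul_const, integral_add_left_eq_self (fun z => |φ z|) y] at hb
    refine hb.trans ?_
    rw [← mul_div_assoc]
    gcongr
    have : 0 ≤ K * (1 + (R + 1) ^ p) := by positivity
    rw [mul_comm]
    linarith

theorem exists_tendsto_truncFracLap (hn : 1 ≤ n) (h1 : (n : ℝ) < p) (h2 : p < n + 2)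
    (hφ : ContDiff ℝ 2 φ) (hc : HasCompactSupport φ) (y : EuclideanSpace ℝ (Fin n)) :
    ∃ J, Tendsto (fun ε => truncFracLap p ε φ y) (𝓝[>] 0) (𝓝 J) := by
  obtain ⟨K, hK0, hK⟩ := exists_second_difference_le hφ hc
  refine ⟨(∫ h, (2 * φ y - φ (y + h) - φ (y - h)) * (‖h‖ ^ p)⁻¹) / 2, ?_⟩
  have hφc := hφ.continuous
  have : Tendsto (fun ε => (∫ h, (2 * φ y - φ (y + h) - φ (y - h)) * truncKernel p ε h) / 2)
      (𝓝[>] 0) (𝓝 ((∫ h, (2 * φ y - φ (y + h) - φ (y - h)) * (‖h‖ ^ p)⁻¹) / 2)) := by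
    refine Tendsto.div_const (tendsto_integral_filter_of_dominated_convergence
      (fun h => K * (min 1 (‖h‖ ^ 2) * (‖h‖ ^ p)⁻¹)) ?_ ?_
      ((integrable_min_one_sq_mul_rpow hn h1 h2).const_mul K) ?_) _
    · exact Eventually.of_forall fun ε => (Measurable.mul (by fun_prop)
        (measurable_truncKernel p ε)).aestronglyMeasurable
    · refine Eventually.of_forall fun ε => ae_of_all _ fun h => ?_
      rw [norm_mul, Real.norm_of_nonneg (truncKernel_nonneg _ _ _), ← mul_assoc]
      exact mul_le_mul (hK y h) (truncKernel_le _ _ _) (truncKernel_nonneg _ _ _) (by positivity)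
    · refine ae_of_all _ fun h => ?_
      rcases eq_or_ne h 0 with rfl | hh
      · simp [two_mul]
      · refine tendsto_const_nhds.congr' ?_
        filter_upwards [Ioo_mem_nhdsGT (norm_pos_iff.2 hh)] with ε hε
        rw [truncKernel_of_le hε.2.le]
  refine this.congr' ?_
  filter_upwards [self_mem_nhdsWithin] with ε hε
  rw [truncFracLap_eq_second_difference hn h1 h2 hε hφc hc]

/-- A `limUnder` carries information only once the limit is known to exist, which the symmetrized
integral provides. -/
theorem tendsto_truncFracLap_fracLaplacian (hn : 1 ≤ n) {s : ℝ} (hs : 0 < s) (hs1 : s < 1)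
    (hφ : ContDiff ℝ 2 φ) (hc : HasCompactSupport φ) (y : EuclideanSpace ℝ (Fin n)) :
    Tendsto (fun ε => fracConst n s * truncFracLap (n + 2 * s) ε φ y) (𝓝[>] 0)
      (𝓝 (fracLaplacian s φ y)) := by
  obtain ⟨J, hJ⟩ := exists_tendsto_truncFracLap (p := n + 2 * s) hn (by linarith) (by linarith)
    hφ hc y
  have : fracLaplacian s φ y = fracConst n s * J := by
    rw [fracLaplacian]
    congr 1
    simp only [← truncFracLap_eq_setIntegral]
    exact hJ.limUnder_eq
  rw [this]
  exact hJ.const_mul _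

theorem stronglyMeasurable_truncFracLap (p ε : ℝ) (hφ : Continuous φ) :
    StronglyMeasurable (truncFracLap p ε φ) := by
  refine StronglyMeasurable.integral_prod_right
    (f := fun y h => (φ y - φ (y + h)) * truncKernel p ε h) ?_
  have := measurable_truncKernel (n := n) p ε
  exact Measurable.stronglyMeasurable (by unfold Function.uncurry; fun_prop)

/-- The distributional fractional Laplacian is the limit of the truncated pairings. -/
theorem tendsto_integral_mul_truncFracLap (hn : 1 ≤ n) {s : ℝ} (hs : 0 < s) (hs1 : s < 1)
    (hφ : ContDiff ℝ 2 φ) (hc : HasCompactSupport φ) {u : EuclideanSpace ℝ (Fin n) → ℝ}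
    (hu : Continuous u) (huL : MemL2s s u) :
    Tendsto (fun ε => fracConst n s * ∫ y, u y * truncFracLap (n + 2 * s) ε φ y) (𝓝[>] 0)
      (𝓝 (∫ y, u y * fracLaplacian s φ y)) := by
  obtain ⟨K, hK0, hK⟩ := exists_abs_truncFracLap_le_decay (p := n + 2 * s) hn (by linarith)
    (by linarith) hφ hc
  simp only [← integral_const_mul]
  refine tendsto_integral_filter_of_dominated_convergence
    (fun y => |fracConst n s| * K * |u y / (1 + ‖y‖ ^ ((n : ℝ) + 2 * s))|) ?_ ?_
    (huL.abs.const_mul _) ?_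
  · have := fun ε => (stronglyMeasurable_truncFracLap (n + 2 * s) ε hφ.continuous).measurable
    exact Eventually.of_forall fun ε => Measurable.aestronglyMeasurable (by fun_prop)
  · filter_upwards [Ioc_mem_nhdsGT (zero_lt_one (α := ℝ))] with ε hε
    refine ae_of_all _ fun y => ?_
    rw [norm_mul, norm_mul, Real.norm_eq_abs, Real.norm_eq_abs, Real.norm_eq_abs, abs_div,
      abs_of_nonneg (show 0 ≤ 1 + ‖y‖ ^ ((n : ℝ) + 2 * s) by positivity)]
    calc _ ≤ |fracConst n s| * (|u y| * (K / (1 + ‖y‖ ^ ((n : ℝ) + 2 * s)))) := by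
          gcongr
          exact hK ε hε.1 hε.2 y
      _ = _ := by ring
  · refine ae_of_all _ fun y => ?_
    refine ((tendsto_truncFracLap_fracLaplacian hn hs hs1 hφ hc y).const_mul (u y)).congr ?_
    intro ε
    ring

/-! ### Fubini for the truncated pairing. -/

/-- The measure-preserving shear `(y, h) ↦ (y, y + h)` turns the majorant into a product of a
function of `y` and a function of `y + h`, each integrable. -/
theorem integrable_uncurry_mul_truncKernel (hp : 0 < p) (hε : 0 < ε)
    (hφ : Continuous φ) (hc : HasCompactSupport φ)
    {u : EuclideanSpace ℝ (Fin n) → ℝ} (hu : Continuous u)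
    (huL : Integrable (fun y => u y / (1 + ‖y‖ ^ p))) :
    Integrable (fun z : EuclideanSpace ℝ (Fin n) × EuclideanSpace ℝ (Fin n) =>
      u z.1 * φ (z.1 + z.2) * truncKernel p ε z.2) (volume.prod volume) := by
  obtain ⟨R, hR0, hR⟩ := hc.isCompact.isBounded.exists_pos_norm_le
  obtain ⟨K, hK0, hK⟩ := exists_truncKernel_le (n := n) hp hε R
  have hφ0 : ∀ z, R < ‖z‖ → φ z = 0 := fun z hz =>
    image_eq_zero_of_notMem_tsupport fun h => hz.not_ge (hR z h)
  have hφi : Integrable φ := hφ.integrable_of_hasCompactSupport hc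
  have hi := (huL.abs.const_mul K).mul_prod hφi.abs
  have hi' := (measurePreserving_prod_add (volume : Measure (EuclideanSpace ℝ (Fin n)))
    (volume : Measure (EuclideanSpace ℝ (Fin n)))).integrable_comp_of_integrable hi
  have := measurable_truncKernel (n := n) p ε
  refine hi'.mono' (Measurable.aestronglyMeasurable (by fun_prop)) (ae_of_all _ fun z => ?_)
  obtain ⟨y, h⟩ := z
  simp only [Function.comp_apply]
  rw [norm_mul, norm_mul, Real.norm_of_nonneg (truncKernel_nonneg _ _ _), Real.norm_eq_abs,
    Real.norm_eq_abs, abs_div, abs_of_nonneg (show 0 ≤ 1 + ‖y‖ ^ p by positivity)]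
  rcases le_or_gt ‖y + h‖ R with hz | hz
  · calc _ ≤ |u y| * |φ (y + h)| * (K / (1 + ‖y‖ ^ p)) := by
          gcongr
          exact hK y h hz
      _ = _ := by ring
  · simp [hφ0 _ hz]

/-- Transfers the operator from `φ` to the correlation of `u` with `φ`, which for a translated
mollifier is a mollification of `u`. The integrability half serves the later pointwise comparison
under the integral. -/
theorem integral_mul_truncFracLap (hn : 1 ≤ n) (h1 : (n : ℝ) < p) (h2 : p < n + 2) (hε : 0 < ε)
    (hφ : Continuous φ) (hc : HasCompactSupport φ)
    {u : EuclideanSpace ℝ (Fin n) → ℝ} (hu : Continuous u)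
    (huL : Integrable (fun y => u y / (1 + ‖y‖ ^ p))) :
    Integrable (fun h => ((∫ y, u y * φ y) - ∫ y, u y * φ (y + h)) * truncKernel p ε h) ∧
    ∫ y, u y * truncFracLap p ε φ y =
      ∫ h, ((∫ y, u y * φ y) - ∫ y, u y * φ (y + h)) * truncKernel p ε h := by
  have hp : 0 < p := (Nat.cast_nonneg n).trans_lt h1
  have hk := integrable_truncKernel hn h1 h2 hε
  have hi : Integrable (fun y => u y * φ y) :=
    (hu.mul hφ).integrable_of_hasCompactSupport hc.mul_left
  have hi' : ∀ h, Integrable (fun y => u y * φ (y + h)) := fun h =>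
    (by fun_prop : Continuous fun y => u y * φ (y + h)).integrable_of_hasCompactSupport
      (hc.comp_homeomorph (Homeomorph.addRight h)).mul_left
  have hj : Integrable (Function.uncurry fun y h =>
      u y * ((φ y - φ (y + h)) * truncKernel p ε h)) (volume.prod volume) := by
    refine ((hi.mul_prod hk).sub
      (integrable_uncurry_mul_truncKernel hp hε hφ hc hu huL)).congr (ae_of_all _ fun z => ?_)
    simp only [Function.uncurry, Pi.sub_apply]
    ring
  have he : ∀ h, ∫ y, u y * ((φ y - φ (y + h)) * truncKernel p ε h) =
      ((∫ y, u y * φ y) - ∫ y, u y * φ (y + h)) * truncKernel p ε h := fun h => by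
    rw [← integral_sub hi (hi' h), ← integral_mul_const]
    congr 1
    ext y
    ring
  refine ⟨hj.integral_prod_right.congr (ae_of_all _ he), ?_⟩
  simp only [truncFracLap, ← integral_const_mul]
  rw [integral_integral_swap hj]
  exact integral_congr_ae (ae_of_all _ he)

/-! ### Comparison at a contact point, and its existence. -/

theorem fracConst_pos (n : ℕ) {s : ℝ} (hs : 0 < s) (hs1 : s < 1) : 0 < fracConst n s := by
  have h1 : 0 < Real.Gamma ((n : ℝ) / 2 + s) := Real.Gamma_pos_of_pos (by positivity)
  have h2 : 0 < Real.Gamma (1 - s) := Real.Gamma_pos_of_pos (by linarith)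
  have := Real.pi_pos
  unfold fracConst
  positivity

theorem integral_truncKernel_pos (hn : 1 ≤ n) {p ε : ℝ} (h1 : (n : ℝ) < p) (h2 : p < n + 2)
    (hε : 0 < ε) : 0 < ∫ h : EuclideanSpace ℝ (Fin n), truncKernel p ε h := by
  have : Nonempty (Fin n) := ⟨⟨0, hn⟩⟩
  rw [integral_pos_iff_support_of_nonneg (truncKernel_nonneg p ε)
    (integrable_truncKernel hn h1 h2 hε)]
  obtain ⟨v, hv⟩ := exists_norm_eq (EuclideanSpace ℝ (Fin n)) (by positivity : 0 ≤ ε + 1)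
  refine (measure_ball_pos volume v one_pos).trans_le (measure_mono fun h hh => ?_)
  have : ε < ‖h‖ := by
    have e1 : ‖v - h‖ < 1 := by rwa [← dist_eq_norm, dist_comm]
    linarith [norm_sub_norm_le v h]
  rw [Function.mem_support, truncKernel_of_le this.le]
  have : 0 < ‖h‖ := hε.trans this
  positivity

/-- If the mollification `U` of `u` touches the test function `δ ζ` (up to a constant) from above
at `a`, at a height at least `M` below its values at distance `≥ r` from `a`, then the truncated
fractional Laplacian of `u` is negative up to the contribution of `ζ`. -/
theorem integral_mul_truncFracLap_le (hn : 1 ≤ n) {p ε r : ℝ} (h1 : (n : ℝ) < p)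
    (h2 : p < n + 2) (hε : 0 < ε) (hεr : ε ≤ r) {u ρ ζ : EuclideanSpace ℝ (Fin n) → ℝ}
    (hu : Continuous u) (huL : Integrable (fun y => u y / (1 + ‖y‖ ^ p)))
    (hρ : Continuous ρ) (hρc : HasCompactSupport ρ) (hζ : Continuous ζ)
    (hζc : HasCompactSupport ζ) {U : EuclideanSpace ℝ (Fin n) → ℝ}
    (hU : ∀ x, U x = ∫ y, u y * ρ (y - x)) {a : EuclideanSpace ℝ (Fin n)} {δ M : ℝ}
    (hmin : ∀ x, U a - δ * ζ a ≤ U x - δ * ζ x)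
    (hfar : ∀ h, r ≤ ‖h‖ → U a - δ * ζ a + M ≤ U (a - h) - δ * ζ (a - h)) :
    ∫ y, u y * truncFracLap p ε (fun y => ρ (y - a)) y ≤
      δ * truncFracLap p ε ζ a - M * ∫ h : EuclideanSpace ℝ (Fin n), truncKernel p r h := by
  obtain ⟨hi, he⟩ := integral_mul_truncFracLap hn h1 h2 hε (φ := fun y => ρ (y - a))
    (by fun_prop) (hρc.comp_homeomorph (Homeomorph.subRight a)) hu huL
  have hsh : ∀ h, ∫ y, u y * ρ (y + h - a) = U (a - h) := fun h => by
    rw [hU]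
    congr 1
    ext y
    congr 2
    abel
  simp only [hsh, ← hU] at hi he
  have hr : 0 < r := hε.trans_le hεr
  have hζi := (integrable_sub_comp_sub_mul_truncKernel hn h1 h2 hε hζ hζc a).const_mul δ
  have hki := (integrable_truncKernel hn h1 h2 hr).const_mul M
  rw [he, ← integral_sub_comp_sub_mul_truncKernel, ← integral_const_mul, ← integral_const_mul,
    ← integral_sub hζi hki]
  refine integral_mono hi (hζi.sub hki) fun h => ?_
  have hk := truncKernel_nonneg p ε h
  -- For `‖h‖ ≥ r` the kernels cut at `ε` and `r` agree and `hfar` yields the gain `M`; for smaller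
  -- `h` minimality alone suffices.
  rcases le_or_gt r ‖h‖ with hh | hh
  · simp only
    rw [truncKernel_of_le hh, ← truncKernel_of_le (hεr.trans hh)]
    nlinarith [mul_le_mul_of_nonneg_right (hfar h hh) hk]
  · simp only
    rw [truncKernel_of_lt hh]
    nlinarith [mul_le_mul_of_nonneg_right (hmin (a - h)) hk]

/-- A non-integrable `f` has Bochner integral `0`, so integrability of the lower order terms never
has to be checked. -/
theorem integral_le_integral_of_ae_le {α : Type*} [MeasurableSpace α] {μ : Measure α}
    {f g : α → ℝ} (hg : Integrable g μ) (hg0 : 0 ≤ g) (h : f ≤ᵐ[μ] g) :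
    ∫ x, f x ∂μ ≤ ∫ x, g x ∂μ := by
  by_cases hf : Integrable f μ
  · exact integral_mono_ae hf hg h
  · rw [integral_undef hf]
    exact integral_nonneg hg0

theorem exists_ae_norm_le_of_memLp_top {α F : Type*} [MeasurableSpace α] [NormedAddCommGroup F]
    {μ : Measure α} {f : α → F} (hf : MemLp f ⊤ μ) : ∃ C, 0 ≤ C ∧ ∀ᵐ x ∂μ, ‖f x‖ ≤ C := by
  refine ⟨(eLpNorm f ⊤ μ).toReal, ENNReal.toReal_nonneg, ?_⟩
  have h := hf.eLpNorm_lt_top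
  rw [eLpNorm_exponent_top] at h ⊢
  filter_upwards [enorm_ae_le_eLpNormEssSup f μ] with x hx
  simpa using ENNReal.toReal_mono h.ne hx

/-- Existence of the contact point: where `u` has a negative minimum at `x₀`, a fine mollification
of `u` touches a small multiple of a bump around `x₀` from above. -/
theorem exists_contact_point {u ζ : EuclideanSpace ℝ (Fin n) → ℝ} (hu : Continuous u)
    (hout : ∀ x ∉ ball (0 : EuclideanSpace ℝ (Fin n)) 1, 0 ≤ u x)
    {x₀ : EuclideanSpace ℝ (Fin n)} (hmin : ∀ x, u x₀ ≤ u x) {r : ℝ} (hr : 0 < r)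
    (hr1 : ball x₀ r ⊆ ball 0 1)
    (hζ : Continuous ζ) (hζ1 : ζ x₀ = 1) (hζ0 : ∀ x, r ≤ dist x x₀ → ζ x = 0)
    {δ : ℝ} (hδ : 0 < δ) :
    ∃ (ρ : ContDiffBump (0 : EuclideanSpace ℝ (Fin n)))
      (a : EuclideanSpace ℝ (Fin n)), ρ.rOut < r ∧ a ∈ closedBall x₀ r ∧
      (∀ x, (∫ y, u y * ρ.normed volume (y - a)) - δ * ζ a ≤
        (∫ y, u y * ρ.normed volume (y - x)) - δ * ζ x) ∧
      (∀ h, 3 ≤ ‖h‖ → (∫ y, u y * ρ.normed volume (y - a)) - δ * ζ a + -u x₀ ≤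
        (∫ y, u y * ρ.normed volume (y - (a - h))) - δ * ζ (a - h)) := by
  obtain ⟨τ', hτ', hτu⟩ := Metric.continuous_iff.1 hu x₀ δ hδ
  -- The three bounds give, in turn, `u < u x₀ + δ` on the mollifier's support around `x₀`, support
  -- radius below `r`, and `U ≥ 0` outside radius `2`.
  set τ := min τ' (min (r / 2) 1) with hτdef
  have hτ : 0 < τ := by positivity
  have hττ' : τ ≤ τ' := min_le_left _ _
  have hτr : τ < r := ((min_le_right _ _).trans (min_le_left _ _)).trans_lt (by linarith)
  have hτ1 : τ ≤ 1 := (min_le_right _ _).trans (min_le_right _ _)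
  let ρ : ContDiffBump (0 : EuclideanSpace ℝ (Fin n)) := ⟨τ / 2, τ, by positivity, by linarith⟩
  set g := ρ.normed volume
  have hg0 : ∀ x, 0 ≤ g x := ρ.nonneg_normed
  have hgc : Continuous g := ρ.continuous_normed
  have hgs : HasCompactSupport g := ρ.hasCompactSupport_normed
  have hgz : ∀ x, τ ≤ ‖x‖ → g x = 0 := fun x hx => by
    by_contra hne
    have : x ∈ Function.support g := hne
    rw [ρ.support_normed_eq, mem_ball_zero_iff] at this
    exact hx.not_gt this
  have hgi : ∀ x, Integrable fun y => g (y - x) := fun x => ρ.integrable_normed.comp_sub_right x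
  have hg1 : ∀ x, ∫ y, g (y - x) = 1 := fun x => by
    rw [integral_sub_right_eq_self g x]
    exact ρ.integral_normed
  have hui : ∀ x, Integrable fun y => u y * g (y - x) := fun x =>
    (by fun_prop : Continuous fun y => u y * g (y - x)).integrable_of_hasCompactSupport
      (hgs.comp_homeomorph (Homeomorph.subRight x)).mul_left
  set U : EuclideanSpace ℝ (Fin n) → ℝ := fun x => ∫ y, u y * g (y - x) with hUdef
  have hUlow : ∀ x, u x₀ ≤ U x := fun x => by
    have : ∫ y, u x₀ * g (y - x) ≤ U x :=
      integral_mono ((hgi x).const_mul _) (hui x)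
        fun y => mul_le_mul_of_nonneg_right (hmin y) (hg0 _)
    rwa [integral_const_mul, hg1, mul_one] at this
  have hUx₀ : U x₀ ≤ u x₀ + δ := by
    have : U x₀ ≤ ∫ y, (u x₀ + δ) * g (y - x₀) := by
      refine integral_mono (hui x₀) ((hgi x₀).const_mul _) fun y => ?_
      rcases le_or_gt τ ‖y - x₀‖ with hy | hy
      · simp [hgz _ hy]
      · refine mul_le_mul_of_nonneg_right ?_ (hg0 _)
        have := hτu y (by rw [dist_eq_norm]; linarith)
        rw [Real.dist_eq] at this
        linarith [(abs_lt.1 this).2]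
    rwa [integral_const_mul, hg1, mul_one] at this
  have hUfar : ∀ x, 2 ≤ ‖x‖ → 0 ≤ U x := fun x hx => by
    refine integral_nonneg fun y => ?_
    rcases le_or_gt τ ‖y - x‖ with hy | hy
    · simp [hgz _ hy]
    · refine mul_nonneg (hout y ?_) (hg0 _)
      rw [mem_ball_zero_iff, not_lt]
      linarith [norm_sub_norm_le x y, norm_sub_rev x y]
  have hUc : Continuous U := by
    have := hgs.continuous_convolution_right (ContinuousLinearMap.mul ℝ ℝ)
      (μ := volume) (f := u) hu.locallyIntegrable hgc
    refine this.congr fun x => ?_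
    rw [convolution_def, hUdef]
    congr 1
    ext y
    rw [ContinuousLinearMap.mul_apply', ← neg_sub y x, show g (-(y - x)) = g (y - x) from
      ρ.normed_neg _]
  have hWc : Continuous fun x => U x - δ * ζ x := by fun_prop
  -- The minimum over this ball is global: at `x₀` the bump lowers the value to at most `u x₀`,
  -- while outside the ball `ζ = 0` and `U ≥ u x₀`.
  obtain ⟨a, ha, hamin⟩ := (isCompact_closedBall x₀ r).exists_isMinOn
    ⟨x₀, mem_closedBall_self hr.le⟩ hWc.continuousOn
  have hax₀ : U a - δ * ζ a ≤ u x₀ := by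
    have := hamin (mem_closedBall_self hr.le)
    change U a - δ * ζ a ≤ U x₀ - δ * ζ x₀ at this
    rw [hζ1] at this
    linarith
  refine ⟨ρ, a, hτr, ha, fun x => ?_, fun h hh => ?_⟩
  · by_cases hx : x ∈ closedBall x₀ r
    · exact hamin hx
    · have := hζ0 x (by simpa using (not_le.1 hx).le)
      change U a - δ * ζ a ≤ U x - δ * ζ x
      rw [this]
      linarith [hUlow x]
  -- From `‖a‖ ≤ 1`, a step of length at least `3` lands outside radius `2`, where `U ≥ 0` and `ζ =
  -- 0`.
  · have ha1 : ‖a‖ ≤ 1 := by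
      have : closedBall x₀ r ⊆ closedBall 0 1 := by
        rw [← closure_ball x₀ hr.ne', ← closure_ball (0 : EuclideanSpace ℝ (Fin n)) one_ne_zero]
        exact closure_mono hr1
      simpa using this ha
    have h2 : 2 ≤ ‖a - h‖ := by linarith [norm_sub_norm_le h a, norm_sub_rev h a]
    have : ζ (a - h) = 0 := hζ0 _ (by
      by_contra! hlt
      have := mem_ball_zero_iff.1 (hr1 (mem_ball.2 hlt))
      linarith)
    change U a - δ * ζ a + -u x₀ ≤ U (a - h) - δ * ζ (a - h)
    rw [this]
    linarith [hUfar _ h2]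

/-- Near an interior minimum with negative value the lower order terms are small from above. -/
theorem exists_lower_order_le {b : EuclideanSpace ℝ (Fin n) → EuclideanSpace ℝ (Fin n)}
    {c u : EuclideanSpace ℝ (Fin n) → ℝ}
    (hb : MemLp b ⊤ (volume.restrict (ball 0 1)))
    (hc0 : ∀ᵐ x ∂(volume.restrict (ball 0 1)), 0 ≤ c x)
    (hu : Continuous u) (hu1 : ContDiffOn ℝ 1 u (ball 0 1))
    {x₀ : EuclideanSpace ℝ (Fin n)} (hx₀ : x₀ ∈ ball (0 : EuclideanSpace ℝ (Fin n)) 1)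
    (hmin : ∀ x, u x₀ ≤ u x) (hneg : u x₀ < 0) {η : ℝ} (hη : 0 < η) :
    ∃ r, 0 < r ∧ ball x₀ r ⊆ ball 0 1 ∧ ∀ᵐ x ∂(volume.restrict (ball 0 1)),
      x ∈ ball x₀ r → inner ℝ (b x) (gradient u x) + c x * u x ≤ η := by
  obtain ⟨B, hB0, hB⟩ := exists_ae_norm_le_of_memLp_top hb
  have hgrad0 : fderiv ℝ u x₀ = 0 :=
    IsLocalMin.fderiv_eq_zero (Eventually.of_forall hmin)
  have hcont : ContinuousAt (fun x => B * ‖fderiv ℝ u x‖) x₀ :=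
    (((hu1.continuousOn_fderiv_of_isOpen isOpen_ball le_rfl).continuousAt
      (isOpen_ball.mem_nhds hx₀)).norm).const_mul B
  have hev : ∀ᶠ x in 𝓝 x₀, x ∈ ball (0 : EuclideanSpace ℝ (Fin n)) 1 ∧ u x < 0 ∧
      B * ‖fderiv ℝ u x‖ < η := by
    filter_upwards [isOpen_ball.mem_nhds hx₀, hu.continuousAt.eventually_lt_const hneg,
      hcont.eventually_lt_const (by simpa [hgrad0] using hη)] with x h1 h2 h3 using ⟨h1, h2, h3⟩
  obtain ⟨r, hr, hball⟩ := Metric.eventually_nhds_iff_ball.1 hev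
  refine ⟨r, hr, fun x hx => (hball x hx).1, ?_⟩
  filter_upwards [hB, hc0] with x hxB hxc hx
  obtain ⟨-, h2, h3⟩ := hball x hx
  have e1 : inner ℝ (b x) (gradient u x) ≤ B * ‖fderiv ℝ u x‖ := by
    refine (real_inner_le_norm _ _).trans ?_
    rw [gradient, LinearIsometryEquiv.norm_map]
    gcongr
  have e2 : c x * u x ≤ 0 := mul_nonpos_of_nonneg_of_nonpos hxc h2.le
  linarith

end FracMax

/-! ### The maximum principle. -/

theorem mainTheorem6 (n : ℕ) (hn : 1 ≤ n) (s : ℝ) (hs : 1 / 2 < s) (hs1 : s < 1)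
    (b : EuclideanSpace ℝ (Fin n) → EuclideanSpace ℝ (Fin n))
    (c u : EuclideanSpace ℝ (Fin n) → ℝ)
    (hb : MemLp b ⊤ (volume.restrict (ball 0 1)))
    (hc : MemLp c ⊤ (volume.restrict (ball 0 1)))
    (hc0 : ∀ᵐ x ∂(volume.restrict (ball 0 1)), 0 ≤ c x)
    (hu : Continuous u) (hu1 : ContDiffOn ℝ 1 u (ball 0 1)) (huL : FracMax.MemL2s s u)
    (hsup : FracMax.IsSupersolution s (FracMax.unitBall n) b c u)
    (hout : ∀ x ∉ ball (0 : EuclideanSpace ℝ (Fin n)) 1, 0 ≤ u x) :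
    ∀ x ∈ ball (0 : EuclideanSpace ℝ (Fin n)) 1, 0 ≤ u x := by
  by_contra! hcon
  obtain ⟨x₁, hx₁, hux₁⟩ := hcon
  obtain ⟨x₀, hx₀, hmin⟩ := (isCompact_closedBall (0 : EuclideanSpace ℝ (Fin n)) 1).exists_isMinOn
    ⟨x₁, ball_subset_closedBall hx₁⟩ hu.continuousOn
  have hneg : u x₀ < 0 := (hmin (ball_subset_closedBall hx₁)).trans_lt hux₁
  have hx₀' : x₀ ∈ ball (0 : EuclideanSpace ℝ (Fin n)) 1 := by
    by_contra h
    exact (hout x₀ h).not_gt hneg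
  replace hmin : ∀ x, u x₀ ≤ u x := fun x => by
    by_cases hx : x ∈ ball (0 : EuclideanSpace ℝ (Fin n)) 1
    · exact hmin (ball_subset_closedBall hx)
    · exact hneg.le.trans (hout x hx)
  have hs0 : 0 < s := by linarith
  have h1 : (n : ℝ) < n + 2 * s := by linarith
  have h2 : (n : ℝ) + 2 * s < n + 2 := by linarith
  have hC := FracMax.fracConst_pos n hs0 hs1
  have hA := FracMax.integral_truncKernel_pos hn h1 h2 (zero_lt_three (α := ℝ))
  set C := FracMax.fracConst n s
  set A := ∫ h : EuclideanSpace ℝ (Fin n), FracMax.truncKernel (n + 2 * s) 3 h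
  have hM : 0 < -u x₀ := by linarith
  set M := -u x₀ with hMdef
  -- The far gain is `C M A = 4η`; the bump and the lower order terms cost at most `η` each, leaving
  -- at most `-2η`.
  obtain ⟨R, hR, hRball, hlow⟩ := FracMax.exists_lower_order_le hb hc0 hu hu1 hx₀' hmin hneg
    (η := C * (M * A) / 4) (by positivity)
  set η := C * (M * A) / 4 with hη
  have hη0 : 0 < η := by positivity
  let ζ : ContDiffBump x₀ := ⟨R / 4, R / 2, by positivity, by linarith⟩
  obtain ⟨K, hK0, hK⟩ := FracMax.exists_abs_truncFracLap_le hn h1 h2 ζ.contDiff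
    ζ.hasCompactSupport
  -- `K + 1` rather than `K`, since `K` may vanish.
  set δ := M * A / (4 * (K + 1)) with hδ
  have hδ0 : 0 < δ := by positivity
  have hδK : δ * K ≤ M * A / 4 := by
    rw [hδ, div_mul_eq_mul_div, div_le_div_iff₀ (by positivity) (by positivity)]
    nlinarith [mul_pos hM hA]
  -- With radius `R / 2` for both the distance from `a` to `x₀` and the mollifier, the test function
  -- is supported in `ball x₀ R`, where `hlow` applies.
  obtain ⟨ρ, a, hτR, ha, hamin, hafar⟩ := FracMax.exists_contact_point hu hout hmin
    (half_pos hR) ((ball_subset_ball (by linarith)).trans hRball) ζ.continuous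
    (ζ.one_of_mem_closedBall (mem_closedBall_self ζ.rIn_pos.le))
    (fun _ hx => ζ.zero_of_le_dist hx) hδ0
  set g := ρ.normed volume
  have hφd2 : ContDiff ℝ (2 : ℕ∞) fun y => g (y - a) :=
    ρ.contDiff_normed.comp (contDiff_id.sub contDiff_const)
  have hφd : ContDiff ℝ (⊤ : ℕ∞) fun y => g (y - a) :=
    ρ.contDiff_normed.comp (contDiff_id.sub contDiff_const)
  have hφc : HasCompactSupport fun y => g (y - a) :=
    ρ.hasCompactSupport_normed.comp_homeomorph (Homeomorph.subRight a)
  have hsupp : Function.support (fun y => g (y - a)) ⊆ closedBall a ρ.rOut := fun y hy => by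
    have : y - a ∈ Function.support g := hy
    rw [ρ.support_normed_eq, mem_ball_zero_iff] at this
    rw [mem_closedBall, dist_eq_norm]
    exact this.le
  have hsub : closedBall a ρ.rOut ⊆ ball x₀ R := closedBall_subset_ball' (by
    rw [mem_closedBall] at ha
    linarith)
  let φ : 𝓓(FracMax.unitBall n, ℝ) := ⟨fun y => g (y - a), hφd, hφc,
    (closure_minimal hsupp isClosed_closedBall).trans (hsub.trans hRball)⟩
  have hg0 : ∀ y, 0 ≤ g (y - a) := fun y => ρ.nonneg_normed _
  have hgi : Integrable fun y => g (y - a) := ρ.integrable_normed.comp_sub_right a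
  have key := hsup φ hg0
  have hfrac : ∫ y, u y * FracMax.fracLaplacian s (fun y => g (y - a)) y ≤ -(3 * η) := by
    refine le_of_tendsto (FracMax.tendsto_integral_mul_truncFracLap hn hs0 hs1
      hφd2 hφc hu huL) ?_
    filter_upwards [Ioo_mem_nhdsGT (zero_lt_three (α := ℝ))] with ε hε
    have := FracMax.integral_mul_truncFracLap_le hn h1 h2 hε.1 hε.2.le hu huL
      ρ.continuous_normed ρ.hasCompactSupport_normed ζ.continuous ζ.hasCompactSupport
      (fun _ => rfl) hamin hafar
    have hle : δ * FracMax.truncFracLap (n + 2 * s) ε ζ a ≤ δ * K := by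
      gcongr
      exact (le_abs_self _).trans (hK ε hε.1 a)
    calc _ ≤ C * (-(3 * (M * A / 4))) := by
          gcongr
          linarith
      _ = _ := by rw [hη]; ring
  have hrest : ∫ x in ball (0 : EuclideanSpace ℝ (Fin n)) 1,
      (inner ℝ (b x) (gradient u x) + c x * u x) * g (x - a) ≤ η := by
    calc _ ≤ ∫ x in ball (0 : EuclideanSpace ℝ (Fin n)) 1, η * g (x - a) := by
          refine FracMax.integral_le_integral_of_ae_le (hgi.const_mul η).integrableOn
            (fun x => mul_nonneg hη0.le (hg0 x)) ?_
          filter_upwards [hlow] with x hx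
          by_cases hxs : x ∈ closedBall a ρ.rOut
          · exact mul_le_mul_of_nonneg_right (hx (hsub hxs)) (hg0 x)
          · simp [Function.notMem_support.1 fun h => hxs (hsupp h)]
      _ ≤ ∫ x, η * g (x - a) := setIntegral_le_integral (hgi.const_mul η)
          (ae_of_all _ fun x => mul_nonneg hη0.le (hg0 x))
      _ = η := by
          rw [integral_const_mul, integral_sub_right_eq_self g a, ρ.integral_normed, mul_one]
  have : 0 ≤ (∫ y, u y * FracMax.fracLaplacian s (fun y => g (y - a)) y) +
      ∫ x in ball (0 : EuclideanSpace ℝ (Fin n)) 1,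
        (inner ℝ (b x) (gradient u x) + c x * u x) * g (x - a) := key
  linarith
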